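/- Let $H$ be a real separable Hilbert space. For a closed convex cone $K\subset H$ (containing $0$) write $x\le y$ for $y-x\in K$, let $K^*=\{x\in H:\langle x,y\rangle\ge 0\ \forall y\in K\}$, and let $P:H\to K$, $Px=\operatorname{argmin}\{\|x-y\|:y\in K\}$, be the metric projection. Call $K$ pointed if $K\cap(-K)=\{0\}$, generating if $K-K=H$, normal if $x_m\to 0$ and $0\le y_m\le x_m$ imply $y_m\to 0$, self-dual if $K=K^*$, and a lattice cone if it is pointed and any two elements of $H$ have a supremum for $\le$. An asymmetric vector norm (aVn) with pointed closed cone range $K$ is a continuous map $Q:H\to H$ such that (1) $Q\circ Q=Q$ and $Q(H)=K$; (2) $Q(tx)=tQx$ for all $t\ge 0$ and $x\in H$; (3) $Q(x+y)\le Qx+Qy$ for all $x,y\in H$; (4) $Qx=Q(-x)=0$ implies $x=0$. It is proper if $Q(x-Qx)=0$ for all $x\in H$. If $K$ is a lattice cone, its lattice aVn is the aVn given by the positive part operator $Lx=0\vee x$. The cone $K$ is coisotone if it is closed, convex, pointed, normal and generating and its metric projection $P$ is a proper aVn. **Proposition.** Let $K\subset H$ be a coisotone cone that is not self-dual. Then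 $K$ is a lattice cone whose positive part operator $L$ is an aVn, and for all $\lambda,\mu\in(0,1)$ with $\lambda+\mu=1$ the map $R=\lambda L+\mu P$ is an aVn with cone range $K$ which is not proper. -/

import Mathlib

open Filter Topology

namespace VectorNorm

section Cones

variable {X : Type*} [AddCommGroup X] [TopologicalSpace X] [Module ℝ X]

/-- The relation `x ≤ y` defined by the closed convex cone `K` (Mathlib's `ProperCone ℝ X` is the
type of closed convex cones containing `0`; it requires neither pointedness nor generation). -/
def ConeLE (K : ProperCone ℝ X) (x y : X) : Prop := y - x ∈ K

/-- `K ∩ (-K) = {0}`. -/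
def IsPointed (K : ProperCone ℝ X) : Prop := (K.toPointedCone : ConvexCone ℝ X).Salient

/-- `K - K = X`. -/
def IsGenerating (K : ProperCone ℝ X) : Prop := (K.toPointedCone : ConvexCone ℝ X).IsReproducing

/-- `K` is normal: if `0 ≤ y_m ≤ x_m` and `x_m → 0`, then `y_m → 0`. -/
def IsNormal (K : ProperCone ℝ X) : Prop :=
  ∀ x y : ℕ → X, (∀ m, x m ∈ K) → Tendsto x atTop (𝓝 0) →
    (∀ m, ConeLE K 0 (y m) ∧ ConeLE K (y m) (x m)) → Tendsto y atTop (𝓝 0)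

/-- `s` is the supremum of `x` and `y` in the order defined by `K`. -/
def IsSup (K : ProperCone ℝ X) (x y s : X) : Prop :=
  ConeLE K x s ∧ ConeLE K y s ∧ ∀ u : X, ConeLE K x u → ConeLE K y u → ConeLE K s u

/-- `K` is a lattice cone: it is pointed and any two elements have a supremum. -/
def IsLatticeCone (K : ProperCone ℝ X) : Prop :=
  IsPointed K ∧ ∀ x y : X, ∃ s : X, IsSup K x y s

/-- `Q` is an asymmetric vector norm with cone range `K`. -/
structure IsAVn (K : ProperCone ℝ X) (Q : X → X) : Prop where
  pointed : IsPointed K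
  continuous : Continuous Q
  idempotent : ∀ x : X, Q (Q x) = Q x
  range_eq : Set.range Q = (K : Set X)
  pos_homogeneous : ∀ (t : ℝ) (x : X), 0 ≤ t → Q (t • x) = t • Q x
  subadditive : ∀ x y : X, ConeLE K (Q (x + y)) (Q x + Q y)
  eq_zero : ∀ x : X, Q x = 0 → Q (-x) = 0 → x = 0

/-- The asymmetric vector norm `Q` is proper: `Q (I - Q) = 0`. -/
def IsProperAVn (K : ProperCone ℝ X) (Q : X → X) : Prop :=
  IsAVn K Q ∧ ∀ x : X, Q (x - Q x) = 0

/-- `L` is the lattice asymmetric vector norm of `K`: `K` is a lattice cone and `L` is an asymmetric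
vector norm which is the positive part operator `x ↦ 0 ∨ x`. -/
def IsLatticeAVn (K : ProperCone ℝ X) (L : X → X) : Prop :=
  IsLatticeCone K ∧ IsAVn K L ∧ ∀ x : X, IsSup K 0 x (L x)

end Cones

section Hilbert

variable {H : Type*} [NormedAddCommGroup H] [InnerProductSpace ℝ H] [CompleteSpace H]

theorem exists_nearest (K : ProperCone ℝ H) (x : H) :
    ∃ p : H, p ∈ K ∧ ∀ y ∈ K, ‖x - p‖ ≤ ‖x - y‖ := by
  have hne : (K : Set H).Nonempty := ⟨0, K.zero_mem⟩
  obtain ⟨p, hp, h⟩ :=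
    exists_norm_eq_iInf_of_complete_convex hne K.isClosed.isComplete K.convex x
  refine ⟨p, hp, fun y hy => ?_⟩
  rw [h]
  exact ciInf_le ⟨0, by rintro _ ⟨z, rfl⟩; exact norm_nonneg _⟩ (⟨y, hy⟩ : (K : Set H))

/-- The metric projection onto the closed convex cone `K`: `P x = argmin {‖x - y‖ : y ∈ K}`. -/
noncomputable def metricProj (K : ProperCone ℝ H) (x : H) : H := (exists_nearest K x).choose

theorem metricProj_mem (K : ProperCone ℝ H) (x : H) : metricProj K x ∈ K :=
  (exists_nearest K x).choose_spec.1

theorem norm_sub_metricProj_le (K : ProperCone ℝ H) (x : H) {y : H} (hy : y ∈ K) :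
    ‖x - metricProj K x‖ ≤ ‖x - y‖ :=
  (exists_nearest K x).choose_spec.2 y hy

/-- `K = K*`, where `K* = {x : ⟪x, y⟫ ≥ 0 for all y ∈ K}`. -/
def IsSelfDual (K : ProperCone ℝ H) : Prop := K = ProperCone.innerDual (K : Set H)

/-- `K` is coisotone: it is a (closed) pointed, normal, generating convex cone, and the metric
projection onto `K` is a proper asymmetric vector norm. -/
structure IsCoisotone (K : ProperCone ℝ H) : Prop where
  pointed : IsPointed K
  normal : IsNormal K
  generating : IsGenerating K
  proper : IsProperAVn K (metricProj K)

end Hilbert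

end VectorNorm

namespace VectorNorm

set_option linter.unusedSectionVars false

variable {H : Type*} [NormedAddCommGroup H] [InnerProductSpace ℝ H] [CompleteSpace H]

open scoped RealInnerProductSpace Pointwise

/-! Everything rests on subadditivity of `P`. With Moreau's `P* x = x + P(-x)`, it says that `P* x`
is the least element of `K*` dominating `x` in the order of `K` (`sub_dualProj_mem`). Hence `K* ⊆
K`, and `P*` is isotone for the order of `K*`. Isotonicity yields positive parts in `K*` for vectors
bounded above, hence the Riesz decomposition property. Normality of `K` makes `K*` generating with
bounded decompositions, so the Riesz–Kantorovich functional of `x` is represented by a vector, which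
is `0 ∨ x` for `K = K**`.

For the last claim, suppose `R` is proper and evaluate at `-k` with `k ∈ K`. There `L` vanishes, and
minimality of `P* k` forces `P(-k) = 0`, that is, `k ∈ K*`. So `K = K*`. -/

/-- The dual cone `K*`. -/
noncomputable abbrev dualCone (K : ProperCone ℝ H) : ProperCone ℝ H :=
  ProperCone.innerDual (K : Set H)

/-- The metric projection onto `K*`, expressed through that onto `K` by Moreau's decomposition. -/
noncomputable def dualProj (K : ProperCone ℝ H) (x : H) : H := x + metricProj K (-x)

/-- The metric projection is subadditive for the order of the cone. -/
def IsSubadditive (K : ProperCone ℝ H) : Prop :=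
  ∀ x y : H, metricProj K x + metricProj K y - metricProj K (x + y) ∈ K

variable {K : ProperCone ℝ H}

/-! ### Metric projections and Moreau's decomposition. -/

theorem inner_nonneg_of_mem {k m : H} (hk : k ∈ K) (hm : m ∈ dualCone K) : 0 ≤ ⟪k, m⟫ :=
  ProperCone.mem_innerDual.1 hm hk

theorem mem_of_forall_dualCone {x : H} (h : ∀ m ∈ dualCone K, 0 ≤ ⟪m, x⟫) : x ∈ K := by
  rw [← ProperCone.innerDual_innerDual K]
  exact ProperCone.mem_innerDual.2 fun m hm => h m hm

/-- A nonempty closed convex set contains a point satisfying the variational inequality of the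
nearest point. -/
theorem exists_variational {C : Set H} (hne : C.Nonempty) (hcl : IsClosed C) (hco : Convex ℝ C)
    (x : H) : ∃ c ∈ C, ∀ y ∈ C, ⟪x - c, y - c⟫ ≤ 0 := by
  obtain ⟨c, hc, h⟩ := exists_norm_eq_iInf_of_complete_convex hne hcl.isComplete hco x
  exact ⟨c, hc, (norm_eq_iInf_iff_real_inner_le_zero hco hc).1 h⟩

theorem inner_sub_metricProj_sub (K : ProperCone ℝ H) (x : H) {y : H} (hy : y ∈ K) :
    ⟪x - metricProj K x, y - metricProj K x⟫ ≤ 0 := by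
  refine (norm_eq_iInf_iff_real_inner_le_zero K.convex (metricProj_mem K x)).1 ?_ y hy
  have : Nonempty (K : Set H) := ⟨⟨0, K.zero_mem⟩⟩
  exact le_antisymm (le_ciInf fun w => norm_sub_metricProj_le K x w.2)
    (ciInf_le ⟨0, by rintro _ ⟨z, rfl⟩; exact norm_nonneg _⟩
      (⟨metricProj K x, metricProj_mem K x⟩ : (K : Set H)))

theorem inner_sub_metricProj_self (K : ProperCone ℝ H) (x : H) :
    ⟪x - metricProj K x, metricProj K x⟫ = 0 := by
  have h1 := inner_sub_metricProj_sub K x K.zero_mem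
  have h2 := inner_sub_metricProj_sub K x
    (K.smul_mem (metricProj_mem K x) (zero_le_two : (0 : ℝ) ≤ 2))
  rw [two_smul, add_sub_cancel_right] at h2
  rw [zero_sub, inner_neg_right] at h1
  linarith

theorem inner_sub_metricProj_nonpos (K : ProperCone ℝ H) (x : H) {y : H} (hy : y ∈ K) :
    ⟪x - metricProj K x, y⟫ ≤ 0 := by
  have h1 := inner_sub_metricProj_sub K x hy
  rwa [inner_sub_right, inner_sub_metricProj_self, sub_zero] at h1

theorem metricProj_eq {x p : H} (hp : p ∈ K) (h0 : ⟪x - p, p⟫ = 0)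
    (h : ∀ y ∈ K, ⟪x - p, y⟫ ≤ 0) : metricProj K x = p := by
  set q := metricProj K x with hq
  have h1 : ⟪x - q, p⟫ ≤ 0 := inner_sub_metricProj_nonpos K x hp
  have h2 : ⟪x - q, q⟫ = 0 := inner_sub_metricProj_self K x
  have h3 := h q (metricProj_mem K x)
  have h4 : ⟪q - p, q - p⟫ ≤ 0 := by
    have : q - p = (x - p) - (x - q) := by abel
    nth_rewrite 1 [this]
    rw [inner_sub_left, inner_sub_right, inner_sub_right]
    linarith
  exact sub_eq_zero.1 (real_inner_self_nonpos.1 h4)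

theorem metricProj_of_mem {x : H} (hx : x ∈ K) : metricProj K x = x :=
  metricProj_eq hx (by simp) (by simp)

theorem metricProj_neg_of_mem_dualCone {m : H} (hm : m ∈ dualCone K) :
    metricProj K (-m) = 0 :=
  metricProj_eq K.zero_mem (by simp) fun y hy => by
    have := inner_nonneg_of_mem hy hm
    rw [sub_zero, inner_neg_left, real_inner_comm]
    linarith

theorem dualProj_of_mem {m : H} (hm : m ∈ dualCone K) : dualProj K m = m := by
  rw [dualProj, metricProj_neg_of_mem_dualCone hm, add_zero]

theorem dualProj_mem (K : ProperCone ℝ H) (x : H) : dualProj K x ∈ dualCone K := by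
  refine ProperCone.mem_innerDual.2 fun y hy => ?_
  have h := inner_sub_metricProj_nonpos K (-x) hy
  have e : dualProj K x = -(-x - metricProj K (-x)) := by rw [dualProj]; abel
  rw [e, inner_neg_right, real_inner_comm]
  linarith

theorem dualProj_sub_self (x : H) : dualProj K x - x = metricProj K (-x) := by
  rw [dualProj, add_sub_cancel_left]

theorem dualProj_sub_self_mem (x : H) : dualProj K x - x ∈ K :=
  dualProj_sub_self (K := K) x ▸ metricProj_mem K (-x)

theorem metricProj_sub_self (x : H) : metricProj K x - x = dualProj K (-x) := by
  rw [dualProj, neg_neg]; abel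

theorem metricProj_sub_self_mem (x : H) : metricProj K x - x ∈ dualCone K :=
  metricProj_sub_self (K := K) x ▸ dualProj_mem K (-x)

theorem inner_dualProj_sub_self (x : H) : ⟪dualProj K x, dualProj K x - x⟫ = 0 := by
  have h := inner_sub_metricProj_self K (-x)
  have e : dualProj K x = -(-x - metricProj K (-x)) := by rw [dualProj]; abel
  rw [dualProj_sub_self, e, inner_neg_left, h, neg_zero]

theorem inner_self_dualProj (x : H) : ⟪x, dualProj K x⟫ = ‖dualProj K x‖ ^ 2 := by
  have h := inner_dualProj_sub_self (K := K) x
  rw [inner_sub_right, real_inner_self_eq_norm_sq] at h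
  rw [real_inner_comm]
  linarith

theorem norm_metricProj_le (x : H) : ‖metricProj K x‖ ≤ ‖x‖ := by
  have h := inner_sub_metricProj_self K x
  rw [inner_sub_left, real_inner_self_eq_norm_sq] at h
  have h2 := real_inner_le_norm x (metricProj K x)
  by_contra! hlt
  have : 0 < ‖metricProj K x‖ := (norm_nonneg x).trans_lt hlt
  nlinarith

/-! ### Order structure of the dual cone. -/

/-- `P* x` is the least element of `K*` that dominates `x` for the order of `K`. -/
theorem sub_dualProj_mem (hs : IsSubadditive K) {x m : H} (hm : m ∈ dualCone K)
    (hx : m - x ∈ K) : m - dualProj K x ∈ K := by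
  have h := hs (-m) (m - x)
  rw [metricProj_neg_of_mem_dualCone hm, metricProj_of_mem hx] at h
  have e : m - dualProj K x = 0 + (m - x) - metricProj K (-m + (m - x)) := by
    rw [dualProj, show -m + (m - x) = -x by abel]; abel
  rwa [e]

/-- Write `m = a - b` with `a, b ∈ K`. Since `P(-m) = 0`, subadditivity at `-m` and `a` reads `0 + a
- b ∈ K`. -/
theorem dualCone_le (hs : IsSubadditive K) (hg : IsGenerating K) {m : H}
    (hm : m ∈ dualCone K) : m ∈ K := by
  have hu : m ∈ ((K.toPointedCone : ConvexCone ℝ H) : Set H) -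
      ((K.toPointedCone : ConvexCone ℝ H) : Set H) := by
    rw [ConvexCone.IsReproducing.sub_eq_univ hg]; trivial
  obtain ⟨a, ha, b, hb, rfl⟩ := Set.mem_sub.1 hu
  replace ha : a ∈ K := ha
  replace hb : b ∈ K := hb
  have h := hs (-(a - b)) a
  rwa [metricProj_neg_of_mem_dualCone hm, metricProj_of_mem ha,
    show -(a - b) + a = b by abel, metricProj_of_mem hb, zero_add] at h

/-- The metric projection onto the dual of a cone with subadditive projection is isotone. -/
theorem dualProj_isotone (hs : IsSubadditive K) {x y : H} (hxy : y - x ∈ dualCone K) :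
    dualProj K y - dualProj K x ∈ dualCone K := by
  set q := dualProj K x with hq
  set Q := dualProj K y with hQ
  set r := dualProj K (Q - q) with hr
  have hqM : q ∈ dualCone K := dualProj_mem K x
  have hQM : Q ∈ dualCone K := dualProj_mem K y
  have hrM : r ∈ dualCone K := dualProj_mem K _
  have hyQ : Q - y ∈ K := dualProj_sub_self_mem y
  have hxq : q - x ∈ K := dualProj_sub_self_mem x
  have hsK : r - (Q - q) ∈ K := dualProj_sub_self_mem _
  -- Minimality of `P*`, used twice, gives `Q ≤ (y - x) + q` and then `r ≤ y - x` for `K`. Pairing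
  -- the residual `r - (Q - q)` with `q`, `Q` and `r` then shows that it vanishes.
  have hle : (y - x) + q - Q ∈ K := by
    refine sub_dualProj_mem hs (add_mem hxy hqM) ?_
    rwa [show y - x + q - y = q - x by abel]
  have hrm : (y - x) - r ∈ K := by
    refine sub_dualProj_mem hs hxy ?_
    rwa [show y - x - (Q - q) = (y - x) + q - Q by abel]
  have h1 : ⟪q, q - x⟫ = 0 := inner_dualProj_sub_self x
  have h2 : 0 ≤ ⟪(q - x) - (r - (Q - q)), q⟫ := by
    refine inner_nonneg_of_mem ?_ hqM
    rw [show (q - x) - (r - (Q - q)) = (Q - y) + ((y - x) - r) by abel]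
    exact add_mem hyQ hrm
  have h3 : 0 ≤ ⟪r - (Q - q), Q⟫ := inner_nonneg_of_mem hsK hQM
  have h4 : ⟪r, r - (Q - q)⟫ = 0 := inner_dualProj_sub_self _
  have h5 : ⟪r - (Q - q), r - (Q - q)⟫ ≤ 0 := by
    rw [inner_sub_left, real_inner_comm] at h2
    have : ⟪r - (Q - q), r - (Q - q)⟫ =
        ⟪r, r - (Q - q)⟫ - ⟪r - (Q - q), Q⟫ + ⟪r - (Q - q), q⟫ := by
      rw [real_inner_comm Q, real_inner_comm q, inner_sub_left, inner_sub_left (x := Q)]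
      ring
    linarith
  have h6 : r = Q - q := sub_eq_zero.1 (real_inner_self_nonpos.1 h5)
  rwa [← h6]

theorem inner_sub_dualProj {u : H} (hu : u ∈ dualCone K) (c : H) :
    0 ≤ ⟪dualProj K c - c, u - dualProj K c⟫ := by
  have h1 := inner_nonneg_of_mem (dualProj_sub_self_mem (K := K) c) hu
  have h2 := inner_dualProj_sub_self (K := K) c
  rw [real_inner_comm] at h2
  rw [inner_sub_right]
  linarith

/-- Any `x` bounded above in the order of `K*` by some `u ≥ 0` has a positive part in that order. -/
theorem exists_dualCone_posPart (hs : IsSubadditive K) {x u₀ : H} (hu : u₀ ∈ dualCone K)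
    (hux : u₀ - x ∈ dualCone K) :
    ∃ c ∈ dualCone K, c - x ∈ dualCone K ∧
      ∀ u ∈ dualCone K, u - x ∈ dualCone K → u - c ∈ dualCone K := by
  -- The lower bounds of all upper bounds of `0` and `x`. The candidate is the point of `C` nearest
  -- to `u₀`.
  let C : Set H := {c | ∀ u ∈ dualCone K, u - x ∈ dualCone K → u - c ∈ dualCone K}
  have hC0 : C.Nonempty := ⟨0, fun u hu _ => by rwa [sub_zero]⟩
  have hCcl : IsClosed C := by
    simp only [C, Set.ofPred_forall]
    refine isClosed_iInter fun u => isClosed_iInter fun _ => isClosed_iInter fun _ => ?_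
    exact (dualCone K).isClosed.preimage (by fun_prop : Continuous fun c : H => u - c)
  have hCco : Convex ℝ C := by
    intro c hc d hd a b ha hb hab u hu hux
    have e : u - (a • c + b • d) = a • (u - c) + b • (u - d) := by
      have : u = a • u + b • u := by rw [← add_smul, hab, one_smul]
      nth_rewrite 1 [this]
      rw [smul_sub, smul_sub]; abel
    rw [e]
    exact add_mem ((dualCone K).smul_mem (hc u hu hux) ha)
      ((dualCone K).smul_mem (hd u hu hux) hb)
  obtain ⟨c, hc, hvar⟩ := exists_variational hC0 hCcl hCco u₀
  -- `z + P*(c - z)` is the projection of `c` onto `z + K*`. If it stays in `C`, the variational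
  -- inequalities at `c` and at this projection force it to equal `c`. For `z = 0` and `z = x`,
  -- isotonicity of `P*` keeps it in `C`.
  have key : ∀ z : H, u₀ - z ∈ dualCone K →
      (z + dualProj K (c - z)) ∈ C → c - z ∈ dualCone K := by
    intro z hz hzC
    have h1 := hvar _ hzC
    have h2 := inner_sub_dualProj hz (c - z)
    set d := dualProj K (c - z) - (c - z) with hd
    rw [show z + dualProj K (c - z) - c = d by rw [hd]; abel] at h1
    rw [show u₀ - z - dualProj K (c - z) = (u₀ - c) - d by rw [hd]; abel, inner_sub_right,
      real_inner_comm] at h2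
    have h3 : d = 0 := real_inner_self_nonpos.1 (by linarith : ⟪d, d⟫ ≤ 0)
    rw [← sub_eq_zero.1 h3]
    exact dualProj_mem K _
  refine ⟨c, ?_, ?_, hc⟩
  · have := key 0 (by rwa [sub_zero]) fun u hu hux => by
      rw [zero_add, sub_zero, ← dualProj_of_mem hu]
      exact dualProj_isotone hs (hc u hu hux)
    rwa [sub_zero] at this
  · refine key x hux fun u hu hux => ?_
    rw [← sub_sub, ← dualProj_of_mem hux]
    exact dualProj_isotone hs (by rw [sub_sub_sub_cancel_right]; exact hc u hu hux)

/-- The Riesz decomposition property of the dual cone. -/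
theorem dualCone_riesz_decomposition (hs : IsSubadditive K) {w a₁ a₂ : H}
    (hw : w ∈ dualCone K) (h₁ : a₁ ∈ dualCone K) (h₂ : a₂ ∈ dualCone K)
    (h : a₁ + a₂ - w ∈ dualCone K) :
    ∃ n₁ ∈ dualCone K, ∃ n₂ ∈ dualCone K, w = n₁ + n₂ ∧
      a₁ - n₁ ∈ dualCone K ∧ a₂ - n₂ ∈ dualCone K := by
  -- Both `w` and `a₁` are upper bounds of `0` and `w - a₂`.
  obtain ⟨c, hc, hcx, hmin⟩ := exists_dualCone_posPart hs (x := w - a₂) hw (by simpa using h₂)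
  refine ⟨c, hc, w - c, hmin w hw (by simpa using h₂), by abel, hmin a₁ h₁ ?_, ?_⟩
  · rwa [show a₁ - (w - a₂) = a₁ + a₂ - w by abel]
  · rwa [show a₂ - (w - c) = c - (w - a₂) by abel]

/-! ### Normality of the cone and generation by its dual. -/

theorem IsNormal.exists_norm_le (hn : IsNormal K) :
    ∃ C : ℝ, 0 ≤ C ∧ ∀ x ∈ K, ∀ y ∈ K, x - y ∈ K → ‖y‖ ≤ C * ‖x‖ := by
  by_contra! hcon
  choose x hx y hy hxy hlt using fun n : ℕ => hcon n n.cast_nonneg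
  have hpos : ∀ n, 0 < ‖y n‖ := fun n =>
    (mul_nonneg n.cast_nonneg (norm_nonneg _)).trans_lt (hlt n)
  have hinv : ∀ n, 0 ≤ ‖y n‖⁻¹ := fun n => inv_nonneg.2 (norm_nonneg _)
  -- The shift to `n + 1` gives the normalized `x` norm at most `1 / (n + 1)`, while the normalized
  -- `y` has norm one.
  have hlim := hn (fun n => ‖y (n + 1)‖⁻¹ • x (n + 1)) (fun n => ‖y (n + 1)‖⁻¹ • y (n + 1))
    (fun n => K.smul_mem (hx _) (hinv _)) ?_ fun n => ⟨?_, ?_⟩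
  · have h1 : Tendsto (fun n : ℕ => ‖‖y (n + 1)‖⁻¹ • y (n + 1)‖) atTop (𝓝 0) := by
      simpa using hlim.norm
    have h2 : (fun n : ℕ => ‖‖y (n + 1)‖⁻¹ • y (n + 1)‖) = fun _ => (1 : ℝ) := by
      funext n
      rw [norm_smul, norm_inv, norm_norm, inv_mul_cancel₀ (hpos _).ne']
    rw [h2] at h1
    exact one_ne_zero (tendsto_nhds_unique tendsto_const_nhds h1)
  · refine squeeze_zero_norm (fun n => ?_) tendsto_one_div_add_atTop_nhds_zero_nat
    have h1 := hlt (n + 1)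
    push_cast at h1
    have h2 : (0 : ℝ) < (n : ℝ) + 1 := by positivity
    rw [norm_smul, norm_inv, norm_norm, inv_mul_le_iff₀ (hpos _), mul_one_div,
      le_div_iff₀ h2]
    linarith
  · rw [ConeLE, sub_zero]
    exact K.smul_mem (hy _) (hinv _)
  · rw [ConeLE, ← smul_sub]
    exact K.smul_mem (hxy _) (hinv _)

/-- Since `y = P y - P*(-y)` and `0 ≤ P y ≤ P y + P(-y) = P* y + P*(-y)`, normality bounds `P y`.
This is the dual estimate that the separation argument needs. -/
theorem norm_le_of_dominated {C : ℝ}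
    (hC : ∀ x ∈ K, ∀ y ∈ K, x - y ∈ K → ‖y‖ ≤ C * ‖x‖) (hC0 : 0 ≤ C) (y : H) :
    ‖y‖ ≤ (C + 1) * (‖dualProj K y‖ + ‖dualProj K (-y)‖) := by
  have h1 := hC (metricProj K y + metricProj K (-y))
    (add_mem (metricProj_mem K _) (metricProj_mem K _)) (metricProj K y) (metricProj_mem K _)
    (by rw [add_sub_cancel_left]; exact metricProj_mem K _)
  have e1 : metricProj K y + metricProj K (-y) = dualProj K y + dualProj K (-y) := by
    rw [dualProj, dualProj, neg_neg]; abel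
  have e2 : y = metricProj K y - dualProj K (-y) := by rw [dualProj, neg_neg]; abel
  have h2 := norm_add_le (dualProj K y) (dualProj K (-y))
  have h3 := norm_sub_le (metricProj K y) (dualProj K (-y))
  rw [← e2] at h3
  rw [e1] at h1
  have h4 := mul_le_mul_of_nonneg_left h2 hC0
  have := norm_nonneg (dualProj K y)
  linarith

/-- A multiple of the unit vector along `P* y` in `K*` realizes `N ‖P* y‖` against `y`. -/
theorem exists_mem_dualCone_inner (y : H) {N : ℝ} (hN : 0 ≤ N) :
    ∃ a ∈ dualCone K, ‖a‖ ≤ N ∧ ⟪y, a⟫ = N * ‖dualProj K y‖ := by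
  refine ⟨(N * ‖dualProj K y‖⁻¹) • dualProj K y,
    (dualCone K).smul_mem (dualProj_mem K y) (by positivity), ?_, ?_⟩
  · rw [norm_smul, Real.norm_of_nonneg (by positivity), mul_assoc]
    exact mul_le_of_le_one_right hN inv_mul_le_one
  · rw [inner_smul_right, inner_self_dualProj]
    rcases eq_or_ne ‖dualProj K y‖ 0 with h | h
    · simp [h]
    · field_simp

/-- A functional `y` separating `h` from `B - B` would satisfy `N (‖P* y‖ + ‖P*(-y)‖) < ⟪y, h⟫`,
against `norm_le_of_dominated`. The error `‖h‖ / 2` makes iteration converge geometrically. -/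
theorem exists_approx_decomposition {C : ℝ}
    (hC : ∀ x ∈ K, ∀ y ∈ K, x - y ∈ K → ‖y‖ ≤ C * ‖x‖) (hC0 : 0 ≤ C) (h : H) :
    ∃ a ∈ dualCone K, ∃ b ∈ dualCone K, ‖a‖ ≤ (C + 1) * ‖h‖ ∧ ‖b‖ ≤ (C + 1) * ‖h‖ ∧
      ‖h - (a - b)‖ ≤ ‖h‖ / 2 := by
  rcases eq_or_ne h 0 with rfl | h0
  · exact ⟨0, zero_mem _, 0, zero_mem _, by simp⟩
  set N := (C + 1) * ‖h‖ with hN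
  have hN0 : 0 ≤ N := by positivity
  let B : Set H := (dualCone K : Set H) ∩ Metric.closedBall 0 N
  have hB : Convex ℝ B := (dualCone K).convex.inter (convex_closedBall 0 N)
  have hmem : h ∈ closure (B - B) := by
    by_contra hnot
    obtain ⟨f, u, hfu, huf⟩ :=
      geometric_hahn_banach_closed_point (hB.sub hB).closure isClosed_closure hnot
    obtain ⟨y, rfl⟩ := (InnerProductSpace.toDual ℝ H).surjective f
    simp only [InnerProductSpace.toDual_apply_apply] at hfu huf
    obtain ⟨a, ha, haN, hay⟩ := exists_mem_dualCone_inner (K := K) y hN0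
    obtain ⟨b, hb, hbN, hby⟩ := exists_mem_dualCone_inner (K := K) (-y) hN0
    have h1 := hfu (a - b) (subset_closure (Set.sub_mem_sub
      ⟨ha, mem_closedBall_zero_iff.2 haN⟩ ⟨hb, mem_closedBall_zero_iff.2 hbN⟩))
    rw [inner_neg_left] at hby
    rw [inner_sub_right] at h1
    have h2 := real_inner_le_norm y h
    have h3 := mul_le_mul_of_nonneg_right (norm_le_of_dominated hC hC0 y) (norm_nonneg h)
    have h4 : (C + 1) * (‖dualProj K y‖ + ‖dualProj K (-y)‖) * ‖h‖ =
        N * ‖dualProj K y‖ + N * ‖dualProj K (-y)‖ := by rw [hN]; ring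
    linarith
  obtain ⟨c, hc, hd⟩ := Metric.mem_closure_iff.1 hmem (‖h‖ / 2) (by positivity)
  obtain ⟨a, ha, b, hb, rfl⟩ := Set.mem_sub.1 hc
  exact ⟨a, ha.1, b, hb.1, mem_closedBall_zero_iff.1 ha.2, mem_closedBall_zero_iff.1 hb.2,
    by rw [← dist_eq_norm]; exact hd.le⟩

theorem tsum_mem_properCone {f : ℕ → H} (hf : ∀ n, f n ∈ K) (hsum : Summable f) :
    ∑' n, f n ∈ K :=
  K.isClosed.mem_of_tendsto hsum.hasSum.tendsto_sum_nat
    (Eventually.of_forall fun _ => sum_mem fun i _ => hf i)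

/-- The dual of a normal cone is generating, with bounded decompositions. -/
theorem IsNormal.exists_decomposition (hn : IsNormal K) :
    ∃ N : ℝ, ∀ h : H, ∃ a ∈ dualCone K, ∃ b ∈ dualCone K,
      h = a - b ∧ ‖a‖ ≤ N * ‖h‖ ∧ ‖b‖ ≤ N * ‖h‖ := by
  obtain ⟨C, hC0, hC⟩ := hn.exists_norm_le
  choose A hA B hB hAn hBn hAB using fun h : H => exists_approx_decomposition hC hC0 h
  refine ⟨2 * (C + 1), fun h => ?_⟩
  -- Successive residuals: each step at least halves the norm, and summing the pieces produces the
  -- exact decomposition.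
  let g : ℕ → H := fun n => (fun x => x - (A x - B x))^[n] h
  have hg0 : g 0 = h := rfl
  have hgs : ∀ n, g (n + 1) = g n - (A (g n) - B (g n)) := fun n =>
    Function.iterate_succ_apply' _ _ _
  have hgn : ∀ n, ‖g n‖ ≤ ‖h‖ * (1 / 2) ^ n := by
    intro n
    induction n with
    | zero => simp [hg0]
    | succ n ih =>
      rw [hgs]
      calc _ ≤ ‖g n‖ / 2 := hAB _
        _ ≤ ‖h‖ * (1 / 2) ^ n / 2 := by gcongr
        _ = _ := by ring
  have hgeo : HasSum (fun n : ℕ => (C + 1) * (‖h‖ * (1 / 2) ^ n)) (2 * (C + 1) * ‖h‖) := by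
    rw [show 2 * (C + 1) * ‖h‖ = (C + 1) * (‖h‖ * 2) by ring]
    exact (hasSum_geometric_two.mul_left ‖h‖).mul_left (C + 1)
  have hbd : ∀ F : H → H, (∀ x, ‖F x‖ ≤ (C + 1) * ‖x‖) → ∀ n,
      ‖F (g n)‖ ≤ (C + 1) * (‖h‖ * (1 / 2) ^ n) := fun F hF n =>
    (hF _).trans (mul_le_mul_of_nonneg_left (hgn n) (by positivity))
  have hsA : Summable fun n => A (g n) :=
    Summable.of_norm_bounded hgeo.summable (hbd A hAn)
  have hsB : Summable fun n => B (g n) :=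
    Summable.of_norm_bounded hgeo.summable (hbd B hBn)
  refine ⟨∑' n, A (g n), tsum_mem_properCone (fun n => hA _) hsA,
    ∑' n, B (g n), tsum_mem_properCone (fun n => hB _) hsB, ?_,
    tsum_of_norm_bounded hgeo (hbd A hAn), tsum_of_norm_bounded hgeo (hbd B hBn)⟩
  have hpart : ∀ n, ∑ i ∈ Finset.range n, (A (g i) - B (g i)) = h - g n := by
    intro n
    induction n with
    | zero => simp [hg0]
    | succ n ih => rw [Finset.sum_range_succ, ih, hgs]; abel
  have hlim : Tendsto g atTop (𝓝 0) := by
    refine squeeze_zero_norm hgn ?_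
    simpa using (tendsto_pow_atTop_nhds_zero_of_lt_one (by norm_num : (0 : ℝ) ≤ 1 / 2)
      (by norm_num)).const_mul ‖h‖
  have h1 := (hsA.sub hsB).hasSum.tendsto_sum_nat
  simp only [hpart] at h1
  rw [← hsA.tsum_sub hsB]
  exact tendsto_nhds_unique (by simpa using tendsto_const_nhds.sub hlim) h1

/-! ### The Riesz–Kantorovich functional and existence of suprema. -/

/-- The Riesz–Kantorovich functional `m ↦ sup {⟪x, n⟫ : 0 ≤ n ≤ m}`, in the order of `K*`. -/
noncomputable def rieszSup (K : ProperCone ℝ H) (x m : H) : ℝ :=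
  sSup {r | ∃ n ∈ dualCone K, m - n ∈ dualCone K ∧ r = ⟪x, n⟫}

/-- As `m - n ∈ K* ⊆ K`, `⟪m - n, n⟫ ≥ 0`. Order intervals of `K*` are thus bounded and the suprema
finite. -/
theorem norm_le_of_sub_mem_dualCone (hMK : ∀ m ∈ dualCone K, m ∈ K) {n m : H}
    (hn : n ∈ dualCone K) (hmn : m - n ∈ dualCone K) : ‖n‖ ≤ ‖m‖ := by
  have h := inner_nonneg_of_mem (hMK _ hmn) hn
  rw [inner_sub_left, real_inner_self_eq_norm_sq] at h
  have h2 := real_inner_le_norm m n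
  by_contra! hlt
  have : 0 < ‖n‖ := (norm_nonneg m).trans_lt hlt
  nlinarith

theorem inner_le_norm_mul (hMK : ∀ m ∈ dualCone K, m ∈ K) (x : H) {n m : H}
    (hn : n ∈ dualCone K) (hmn : m - n ∈ dualCone K) : ⟪x, n⟫ ≤ ‖x‖ * ‖m‖ :=
  (real_inner_le_norm x n).trans
    (mul_le_mul_of_nonneg_left (norm_le_of_sub_mem_dualCone hMK hn hmn) (norm_nonneg x))

theorem le_rieszSup (hMK : ∀ m ∈ dualCone K, m ∈ K) (x : H) {n m : H}
    (hn : n ∈ dualCone K) (hmn : m - n ∈ dualCone K) : ⟪x, n⟫ ≤ rieszSup K x m :=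
  le_csSup ⟨‖x‖ * ‖m‖, by
    rintro _ ⟨n, hn, hmn, rfl⟩; exact inner_le_norm_mul hMK x hn hmn⟩ ⟨n, hn, hmn, rfl⟩

theorem rieszSup_le {x m : H} {c : ℝ} (hm : m ∈ dualCone K)
    (h : ∀ n ∈ dualCone K, m - n ∈ dualCone K → ⟪x, n⟫ ≤ c) : rieszSup K x m ≤ c :=
  csSup_le ⟨_, 0, zero_mem _, by rwa [sub_zero], rfl⟩ (by
    rintro _ ⟨n, hn, hmn, rfl⟩; exact h n hn hmn)

theorem rieszSup_nonneg (hMK : ∀ m ∈ dualCone K, m ∈ K) (x : H) {m : H}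
    (hm : m ∈ dualCone K) : 0 ≤ rieszSup K x m := by
  simpa using le_rieszSup hMK x (zero_mem (dualCone K)) (by rwa [sub_zero])

theorem rieszSup_add (hs : IsSubadditive K) (hMK : ∀ m ∈ dualCone K, m ∈ K) (x : H)
    {m₁ m₂ : H} (h₁ : m₁ ∈ dualCone K) (h₂ : m₂ ∈ dualCone K) :
    rieszSup K x (m₁ + m₂) = rieszSup K x m₁ + rieszSup K x m₂ := by
  refine le_antisymm (rieszSup_le (add_mem h₁ h₂) fun w hw hmw => ?_) ?_
  · obtain ⟨n₁, hn₁, n₂, hn₂, rfl, hd₁, hd₂⟩ := dualCone_riesz_decomposition hs hw h₁ h₂ hmw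
    rw [inner_add_right]
    exact add_le_add (le_rieszSup hMK x hn₁ hd₁) (le_rieszSup hMK x hn₂ hd₂)
  · rw [← le_sub_iff_add_le]
    refine rieszSup_le h₁ fun n₁ hn₁ hd₁ => ?_
    rw [le_sub_comm]
    refine rieszSup_le h₂ fun n₂ hn₂ hd₂ => ?_
    rw [le_sub_iff_add_le', ← inner_add_right]
    exact le_rieszSup hMK x (add_mem hn₁ hn₂) (by
      rw [add_sub_add_comm]; exact add_mem hd₁ hd₂)

/-- The Riesz–Kantorovich functional is represented by a vector. -/
theorem exists_inner_eq_rieszSup (hs : IsSubadditive K) (hMK : ∀ m ∈ dualCone K, m ∈ K)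
    (hn : IsNormal K) (x : H) : ∃ z : H, ∀ m ∈ dualCone K, ⟪z, m⟫ = rieszSup K x m := by
  obtain ⟨N, hN⟩ := hn.exists_decomposition
  choose A hA B hB hAB hAn hBn using hN
  -- The difference does not depend on the decomposition, which makes the extension to `H` additive.
  have hwd : ∀ h : H, ∀ a ∈ dualCone K, ∀ b ∈ dualCone K, h = a - b →
      rieszSup K x (A h) - rieszSup K x (B h) = rieszSup K x a - rieszSup K x b := by
    intro h a ha b hb e
    have e2 : A h + b = a + B h := by
      have := (hAB h).symm.trans e
      rw [sub_eq_sub_iff_add_eq_add] at this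
      exact this
    have := congrArg (rieszSup K x) e2
    rw [rieszSup_add hs hMK x (hA h) hb, rieszSup_add hs hMK x ha (hB h)] at this
    linarith
  let φ : H →+ ℝ := AddMonoidHom.mk' (fun h => rieszSup K x (A h) - rieszSup K x (B h))
    fun h k => by
      rw [hwd (h + k) (A h + A k) (add_mem (hA h) (hA k)) (B h + B k) (add_mem (hB h) (hB k))
        (by nth_rewrite 1 [hAB h, hAB k]; abel), rieszSup_add hs hMK x (hA h) (hA k),
        rieszSup_add hs hMK x (hB h) (hB k)]
      ring
  have hφ : Continuous φ := by
    refine AddMonoidHomClass.continuous_of_bound φ (‖x‖ * N) fun h => ?_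
    have hle : ∀ m ∈ dualCone K, ‖m‖ ≤ N * ‖h‖ → rieszSup K x m ≤ ‖x‖ * N * ‖h‖ :=
      fun m hm hmn => rieszSup_le hm fun n hn hd => (inner_le_norm_mul hMK x hn hd).trans (by
        rw [mul_assoc]; exact mul_le_mul_of_nonneg_left hmn (norm_nonneg x))
    have h1 := hle _ (hA h) (hAn h)
    have h2 := hle _ (hB h) (hBn h)
    have h3 := rieszSup_nonneg hMK x (hA h)
    have h4 := rieszSup_nonneg hMK x (hB h)
    rw [Real.norm_eq_abs, abs_le]
    change _ ≤ rieszSup K x (A h) - rieszSup K x (B h) ∧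
      rieszSup K x (A h) - rieszSup K x (B h) ≤ _
    constructor <;> linarith
  -- A continuous additive map is real-linear, so homogeneity need not be checked.
  refine ⟨(InnerProductSpace.toDual ℝ H).symm (φ.toRealLinearMap hφ), fun m hm => ?_⟩
  rw [InnerProductSpace.toDual_symm_apply]
  change rieszSup K x (A m) - rieszSup K x (B m) = _
  rw [hwd m m hm 0 (zero_mem _) (sub_zero m).symm]
  have : rieszSup K x (0 + 0) = _ := rieszSup_add hs hMK x (zero_mem _) (zero_mem _)
  rw [add_zero] at this
  linarith

/-- By `K = K**` the order is tested against `m ∈ K*`. Taking `n = 0` and `n = m` shows that `z` is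
an upper bound; for another upper bound `u`, `⟪x, n⟫ ≤ ⟪u, n⟫ ≤ ⟪u, m⟫`. -/
theorem exists_isSup_zero (hs : IsSubadditive K) (hMK : ∀ m ∈ dualCone K, m ∈ K)
    (hn : IsNormal K) (x : H) : ∃ z : H, IsSup K 0 x z := by
  obtain ⟨z, hz⟩ := exists_inner_eq_rieszSup hs hMK hn x
  refine ⟨z, mem_of_forall_dualCone fun m hm => ?_, mem_of_forall_dualCone fun m hm => ?_,
    fun u hu hux => mem_of_forall_dualCone fun m hm => ?_⟩
  · rw [sub_zero, real_inner_comm, hz m hm]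
    exact rieszSup_nonneg hMK x hm
  · rw [real_inner_comm, inner_sub_left, hz m hm, sub_nonneg]
    exact le_rieszSup hMK x hm (by rw [sub_self]; exact zero_mem _)
  · rw [real_inner_comm, inner_sub_left, hz m hm, sub_nonneg]
    refine rieszSup_le hm fun n hn' hd => ?_
    have h1 := inner_nonneg_of_mem hux hn'
    have h2 := inner_nonneg_of_mem hu hd
    rw [sub_zero, inner_sub_right] at h2
    rw [inner_sub_left] at h1
    linarith

/-! ### The positive part operator as an asymmetric vector norm. -/

theorem IsPointed.eq_zero (hp : IsPointed K) {x : H} (hx : x ∈ K) (hx' : -x ∈ K) : x = 0 := by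
  by_contra h
  exact hp x hx h hx'

theorem IsPointed.eq_zero_of_add (hp : IsPointed K) {x y : H} (hx : x ∈ K) (hy : y ∈ K)
    (h : x + y = 0) : x = 0 :=
  hp.eq_zero hx (by rwa [neg_eq_of_add_eq_zero_right h])

theorem IsSup.unique (hp : IsPointed K) {x y s t : H} (hs : IsSup K x y s)
    (ht : IsSup K x y t) : s = t :=
  sub_eq_zero.1 (hp.eq_zero (ht.2.2 s hs.1 hs.2.1)
    (by rw [neg_sub]; exact hs.2.2 t ht.1 ht.2.1))

theorem isSup_zero_of_mem {x : H} (hx : x ∈ K) : IsSup K 0 x x :=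
  ⟨by rwa [ConeLE, sub_zero], by rw [ConeLE, sub_self]; exact K.zero_mem, fun _ _ hu => hu⟩

theorem isSup_zero_of_neg_mem {x : H} (hx : -x ∈ K) : IsSup K 0 x 0 :=
  ⟨by rw [ConeLE, sub_self]; exact K.zero_mem, by rwa [ConeLE, zero_sub], fun _ hu _ => hu⟩

theorem IsSup.smul {x y s : H} (hs : IsSup K x y s) {t : ℝ} (ht : 0 < t) :
    IsSup K (t • x) (t • y) (t • s) := by
  refine ⟨?_, ?_, fun u hx hy => ?_⟩
  · rw [ConeLE, ← smul_sub]; exact K.smul_mem hs.1 ht.le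
  · rw [ConeLE, ← smul_sub]; exact K.smul_mem hs.2.1 ht.le
  · have e : ∀ w : H, u - t • w = t • (t⁻¹ • u - w) := fun w => by
      rw [smul_sub, smul_inv_smul₀ ht.ne']
    have e' : ∀ w : H, t⁻¹ • u - w = t⁻¹ • (u - t • w) := fun w => by
      rw [smul_sub, inv_smul_smul₀ ht.ne']
    have hi : 0 ≤ t⁻¹ := (inv_pos.2 ht).le
    rw [ConeLE, e]
    refine K.smul_mem (hs.2.2 _ ?_ ?_) ht.le
    · rw [ConeLE, e']; exact K.smul_mem hx hi
    · rw [ConeLE, e']; exact K.smul_mem hy hi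

theorem IsSup.add_left {x y s : H} (hs : IsSup K 0 (y - x) s) : IsSup K x y (x + s) := by
  refine ⟨?_, ?_, fun u hx hy => ?_⟩
  · have := hs.1
    rwa [ConeLE, add_sub_cancel_left, ← sub_zero s]
  · have := hs.2.1
    rwa [ConeLE, show x + s - y = s - (y - x) by abel]
  · rw [ConeLE, ← sub_sub]
    refine hs.2.2 (u - x) ?_ ?_
    · rwa [ConeLE, sub_zero]
    · rwa [ConeLE, sub_sub_sub_cancel_right]

theorem IsSup.sub_mem_of_add {x y s t r : H} (hs : IsSup K 0 x s) (ht : IsSup K 0 y t)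
    (hr : IsSup K 0 (x + y) r) : s + t - r ∈ K := by
  refine hr.2.2 _ ?_ ?_
  · have := add_mem hs.1 ht.1
    rwa [sub_zero, sub_zero, ← sub_zero (s + t)] at this
  · rw [ConeLE, add_sub_add_comm]
    exact add_mem hs.2.1 ht.2.1

/-- The positive part operator of a normal cone containing its dual is continuous. -/
theorem continuous_of_isSup (hn : IsNormal K) (hMK : ∀ m ∈ dualCone K, m ∈ K) {L : H → H}
    (hL : ∀ x, IsSup K 0 x (L x)) : Continuous L := by
  obtain ⟨C, hC0, hC⟩ := hn.exists_norm_le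
  have hmem : ∀ x, L x ∈ K := fun x => by simpa [ConeLE] using (hL x).1
  -- `P x - x ∈ K* ⊆ K`, so `P x` is an upper bound of `0` and `x`, whence `0 ≤ L x ≤ P x`.
  have hbd : ∀ x, ‖L x‖ ≤ C * ‖x‖ := fun x =>
    (hC (metricProj K x) (metricProj_mem K x) (L x) (hmem x) ((hL x).2.2 _
      (by rw [ConeLE, sub_zero]; exact metricProj_mem K x)
      (hMK _ (metricProj_sub_self_mem x)))).trans
      (mul_le_mul_of_nonneg_left (norm_metricProj_le x) hC0)
  have hsub : ∀ x y, L (x - y) + L y - L x ∈ K := fun x y =>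
    (hL (x - y)).sub_mem_of_add (hL y) (by rw [sub_add_cancel]; exact hL x)
  have hlip : ∀ x y, ‖L x - L y‖ ≤ (C * (C + C) + C) * ‖x - y‖ := by
    intro x y
    -- `L x - L y` lies between `-L (y - x)` and `L (x - y)`; adding `L (y - x)` moves it into `K`,
    -- where normality applies.
    have h1 : ‖L x - L y + L (y - x)‖ ≤ C * ‖L (x - y) + L (y - x)‖ := by
      refine hC _ (add_mem (hmem _) (hmem _)) _ ?_ ?_
      · have := hsub y x
        rwa [show L x - L y + L (y - x) = L (y - x) + L x - L y by abel]
      · have := hsub x y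
        rwa [show L (x - y) + L (y - x) - (L x - L y + L (y - x)) =
          L (x - y) + L y - L x by abel]
    have h2 : ‖L x - L y‖ ≤ ‖L x - L y + L (y - x)‖ + ‖L (y - x)‖ := by
      simpa using norm_sub_le (L x - L y + L (y - x)) (L (y - x))
    have h3 := norm_add_le (L (x - y)) (L (y - x))
    have h4 := hbd (x - y)
    have h5 := hbd (y - x)
    rw [norm_sub_rev y x] at h5
    have h6 := mul_le_mul_of_nonneg_left (h3.trans (add_le_add h4 h5)) hC0
    linarith
  have : LipschitzWith (Real.toNNReal (C * (C + C) + C)) L := by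
    refine LipschitzWith.of_dist_le_mul fun x y => ?_
    rw [dist_eq_norm, dist_eq_norm, Real.coe_toNNReal _ (by positivity)]
    exact hlip x y
  exact this.continuous

theorem isAVn_of_isSup (hp : IsPointed K) {L : H → H} (hc : Continuous L)
    (hL : ∀ x, IsSup K 0 x (L x)) : IsAVn K L := by
  have hmem : ∀ x, L x ∈ K := fun x => by simpa [ConeLE] using (hL x).1
  have hfix : ∀ x ∈ K, L x = x := fun x hx => (hL x).unique hp (isSup_zero_of_mem hx)
  refine ⟨hp, hc, fun x => hfix _ (hmem x), ?_, fun t x ht => ?_,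
    fun x y => (hL x).sub_mem_of_add (hL y) (hL _), fun x h h' => ?_⟩
  · ext x
    exact ⟨by rintro ⟨y, rfl⟩; exact hmem y, fun hx => ⟨x, hfix x hx⟩⟩
  · rcases ht.eq_or_lt with rfl | ht
    · rw [zero_smul, zero_smul, hfix 0 K.zero_mem]
    · have := (hL x).smul ht
      rw [smul_zero] at this
      exact (hL _).unique hp this
  · have h1 := (hL x).2.1
    have h2 := (hL (-x)).2.1
    rw [h, ConeLE, zero_sub] at h1
    rw [h', ConeLE, zero_sub, neg_neg] at h2
    exact hp.eq_zero h2 h1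

theorem IsAVn.mem {Q : H → H} (h : IsAVn K Q) (x : H) : Q x ∈ K := by
  have : Q x ∈ Set.range Q := Set.mem_range_self x
  rwa [h.range_eq] at this

theorem IsAVn.eq_self {Q : H → H} (h : IsAVn K Q) {x : H} (hx : x ∈ K) : Q x = x := by
  obtain ⟨y, rfl⟩ : x ∈ Set.range Q := by rw [h.range_eq]; exact hx
  exact h.idempotent y

/-! ### Convex combinations and failure of properness. -/

/-- A convex combination of two asymmetric vector norms with the same cone range is again one. -/
theorem IsAVn.convexCombination {Q₁ Q₂ : H → H} (h₁ : IsAVn K Q₁) (h₂ : IsAVn K Q₂)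
    {a b : ℝ} (ha : 0 < a) (hb : 0 ≤ b) (hab : a + b = 1) :
    IsAVn K fun x => a • Q₁ x + b • Q₂ x := by
  have hmem' : ∀ x, a • Q₁ x + b • Q₂ x ∈ K := fun x =>
    add_mem (K.smul_mem (h₁.mem x) ha.le) (K.smul_mem (h₂.mem x) hb)
  have hfix' : ∀ x ∈ K, a • Q₁ x + b • Q₂ x = x := fun x hx => by
    rw [h₁.eq_self hx, h₂.eq_self hx, ← add_smul, hab, one_smul]
  refine ⟨h₁.pointed, (h₁.continuous.const_smul a).add (h₂.continuous.const_smul b),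
    fun x => hfix' _ (hmem' x), ?_, fun t x ht => ?_, fun x y => ?_, fun x h h' => ?_⟩
  · ext x
    exact ⟨by rintro ⟨y, rfl⟩; exact hmem' y, fun hx => ⟨x, hfix' x hx⟩⟩
  · simp only [h₁.pos_homogeneous t x ht, h₂.pos_homogeneous t x ht, smul_add, smul_comm t]
  · rw [ConeLE]
    have := add_mem (K.smul_mem (h₁.subadditive x y) ha.le)
      (K.smul_mem (h₂.subadditive x y) hb)
    convert this using 1
    module
  · have key : ∀ y, a • Q₁ y + b • Q₂ y = 0 → Q₁ y = 0 := fun y hy =>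
      (smul_eq_zero.1 (h₁.pointed.eq_zero_of_add (K.smul_mem (h₁.mem y) ha.le)
        (K.smul_mem (h₂.mem y) hb) hy)).resolve_left ha.ne'
    exact h₁.eq_zero x (key x h) (key (-x) h')

/-- If a convex combination of the lattice operator and the metric projection is proper, then
`K` is contained in its dual. -/
theorem mem_dualCone_of_proper (hs : IsSubadditive K) (hp : IsPointed K) {L : H → H}
    (hLmem : ∀ x, L x ∈ K) (hL : ∀ x, IsSup K 0 x (L x)) {a b : ℝ} (ha : 0 < a) (hb : 0 < b)
    (hab : a + b = 1)
    (hR : ∀ x, a • L (x - (a • L x + b • metricProj K x)) +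
      b • metricProj K (x - (a • L x + b • metricProj K x)) = 0) {k : H} (hk : k ∈ K) :
    k ∈ dualCone K := by
  have h := hR (-k)
  rw [(hL (-k)).unique hp (isSup_zero_of_neg_mem (by rwa [neg_neg])), smul_zero, zero_add] at h
  set p := metricProj K (-k) with hpk
  have hpK : p ∈ K := metricProj_mem K _
  have h0 : metricProj K (-k - b • p) = 0 := by
    rw [add_comm] at h
    exact (smul_eq_zero.1 (hp.eq_zero_of_add (K.smul_mem (metricProj_mem K _) hb.le)
      (K.smul_mem (hLmem _) ha.le) h)).resolve_left hb.ne'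
  have hm : k + b • p ∈ dualCone K := by
    have := metricProj_sub_self_mem (K := K) (-k - b • p)
    rwa [h0, show (0 : H) - (-k - b • p) = k + b • p by abel] at this
  -- `k + b p` lies in `K*` and dominates `k`, hence dominates `P* k = k + p`; as `b < 1` and `K` is
  -- pointed, `p = 0`.
  have h1 : k + b • p - dualProj K k ∈ K :=
    sub_dualProj_mem hs hm (by rw [add_sub_cancel_left]; exact K.smul_mem hpK hb.le)
  have e : k + b • p - dualProj K k = -(a • p) := by
    rw [dualProj, ← hpk, eq_sub_of_add_eq hab, sub_smul, one_smul]; abel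
  rw [e] at h1
  have hp0 : p = 0 :=
    (smul_eq_zero.1 (hp.eq_zero (K.smul_mem hpK ha.le) h1)).resolve_left ha.ne'
  rwa [hp0, smul_zero, add_zero] at hm

end VectorNorm

theorem mainTheorem5 {H : Type*} [NormedAddCommGroup H] [InnerProductSpace ℝ H] [CompleteSpace H]
    [TopologicalSpace.SeparableSpace H] (K : ProperCone ℝ H)
    (hK : VectorNorm.IsCoisotone K) (hself : ¬ VectorNorm.IsSelfDual K) :
    (∃ L : H → H, VectorNorm.IsLatticeAVn K L) ∧
    ∀ L : H → H, VectorNorm.IsLatticeAVn K L →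
      ∀ a b : ℝ, a ∈ Set.Ioo (0 : ℝ) 1 → b ∈ Set.Ioo (0 : ℝ) 1 → a + b = 1 →
        VectorNorm.IsAVn K (fun x => a • L x + b • VectorNorm.metricProj K x) ∧
        ¬ VectorNorm.IsProperAVn K (fun x => a • L x + b • VectorNorm.metricProj K x) := by
  have hs : VectorNorm.IsSubadditive K := hK.proper.1.subadditive
  have hMK : ∀ m ∈ VectorNorm.dualCone K, m ∈ K := fun m hm =>
    VectorNorm.dualCone_le hs hK.generating hm
  refine ⟨?_, fun L hL a b ha hb hab => ⟨?_, fun hR => hself ?_⟩⟩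
  · choose L hL using VectorNorm.exists_isSup_zero hs hMK hK.normal
    exact ⟨L, ⟨hK.pointed, fun x y => ⟨x + L (y - x), (hL (y - x)).add_left⟩⟩,
      VectorNorm.isAVn_of_isSup hK.pointed
        (VectorNorm.continuous_of_isSup hK.normal hMK hL) hL, hL⟩
  · exact hL.2.1.convexCombination hK.proper.1 ha.1 hb.1.le hab
  · refine le_antisymm (fun k hk => ?_) hMK
    exact VectorNorm.mem_dualCone_of_proper hs hK.pointed hL.2.1.mem hL.2.2 ha.1 hb.1 hab
      hR.2 hk
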